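/- Let $\mathscr{H}^+$ (the $^+$stable limit double affine Hecke algebra) be the unital associative $\mathbb{Q}(\mathfrak t,\mathfrak q)$-algebra generated by elements $T_i, X_i, Y_i$, $i\ge 1$, subject to the relations $$T_iT_j=T_jT_i\ (|i-j|>1),\qquad T_iT_{i+1}T_i=T_{i+1}T_iT_{i+1},\qquad (T_i-1)(T_i+\mathfrak t)=0,$$ $$\mathfrak t\,T_i^{-1}X_iT_i^{-1}=X_{i+1},\qquad T_iX_j=X_jT_i\ (j\ne i,i+1),\qquad X_iX_j=X_jX_i,$$ $$\mathfrak t^{-1}T_iY_iT_i=Y_{i+1},\qquad T_iY_j=Y_jT_i\ (j\ne i,i+1),\qquad Y_iY_j=Y_jY_i,$$ $$Y_1T_1X_1=X_2Y_1T_1,$$ for all $i,j\ge1$, where $T_i^{-1}=\mathfrak t^{-1}(T_i+\mathfrak t-1)$ is the inverse of $T_i$ provided by the quadratic relation. Let $\mathfrak a,\mathfrak b:\mathscr{H}^+\to\mathscr{H}^+$ be the $\mathbb{Q}(\mathfrak t,\mathfrak q)$-algebra endomorphisms given, for all $i\ge1$, by $$\mathfrak a(T_i)=T_i,\quad \mathfrak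 a(X_i)=X_i,\quad \mathfrak a(Y_i)=\mathfrak t^{\,1-i}(T_{i-1}\cdots T_1)(T_1\cdots T_{i-1})X_iY_i,$$ $$\mathfrak b(T_i)=T_i,\quad \mathfrak b(Y_i)=Y_i,\quad \mathfrak b(X_i)=\mathfrak t^{\,i-1}(T_{i-1}^{-1}\cdots T_1^{-1})(T_1^{-1}\cdots T_{i-1}^{-1})Y_iX_i.$$ Then $\mathfrak a$ and $\mathfrak b$ generate a free monoid on two generators: the submonoid of the monoid of algebra endomorphisms of $\mathscr{H}^+$ (under composition) generated by $\mathfrak a$ and $\mathfrak b$ is free with basis $\{\mathfrak a,\mathfrak b\}$, with $\mathfrak a\neq\mathfrak b$; that is, there is an isomorphism onto it from the free monoid on two letters that sends the two letters to $\mathfrak a$ and $\mathfrak b$. -/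

import Mathlib

namespace StableDAHA

/-! ### The ground field and the algebra -/

/-- The field `ℚ(𝓉, 𝓆)` of rational functions in two parameters. -/
def K : Type := FractionRing (MvPolynomial (Fin 2) ℚ)

noncomputable instance : Field K :=
  inferInstanceAs (Field (FractionRing (MvPolynomial (Fin 2) ℚ)))

noncomputable instance : Algebra (MvPolynomial (Fin 2) ℚ) K :=
  inferInstanceAs (Algebra (MvPolynomial (Fin 2) ℚ) (FractionRing (MvPolynomial (Fin 2) ℚ)))

instance : IsFractionRing (MvPolynomial (Fin 2) ℚ) K :=
  inferInstanceAs (IsFractionRing (MvPolynomial (Fin 2) ℚ) (FractionRing (MvPolynomial (Fin 2) ℚ)))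

/-- The parameter `𝓉`. -/
noncomputable def tc : K := algebraMap (MvPolynomial (Fin 2) ℚ) K (MvPolynomial.X 0)

/-- The parameter `𝓆`. It belongs to the ground field, but no relation involves it. -/
noncomputable def qc : K := algebraMap (MvPolynomial (Fin 2) ℚ) K (MvPolynomial.X 1)

/-- The generators. Indices are shifted by one: `T n`, `X n`, `Y n` stand for
`T_{n+1}`, `X_{n+1}`, `Y_{n+1}`, so that `n : ℕ` runs over all the indices `i = n + 1 ≥ 1`. -/
inductive Gen : Type
  | T (n : ℕ)
  | X (n : ℕ)
  | Y (n : ℕ)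

namespace Free

/-- `T_{n+1}` in the free algebra. -/
noncomputable def T (n : ℕ) : FreeAlgebra K Gen := FreeAlgebra.ι K (Gen.T n)

/-- `X_{n+1}` in the free algebra. -/
noncomputable def X (n : ℕ) : FreeAlgebra K Gen := FreeAlgebra.ι K (Gen.X n)

/-- `Y_{n+1}` in the free algebra. -/
noncomputable def Y (n : ℕ) : FreeAlgebra K Gen := FreeAlgebra.ι K (Gen.Y n)

/-- The element `𝓉⁻¹ (T + 𝓉 - 1)`; the quadratic relation `(T - 1) (T + 𝓉) = 0` says exactly
that it is the inverse of `T`. -/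
noncomputable def Tinv (n : ℕ) : FreeAlgebra K Gen :=
  tc⁻¹ • (T n + algebraMap K (FreeAlgebra K Gen) (tc - 1))

end Free

open Free in
/-- The defining relations of the `+`stable limit DAHA. -/
inductive Rel : FreeAlgebra K Gen → FreeAlgebra K Gen → Prop
  | T_comm (i j : ℕ) (h : i + 1 < j ∨ j + 1 < i) : Rel (T i * T j) (T j * T i)
  | T_braid (i : ℕ) : Rel (T i * T (i + 1) * T i) (T (i + 1) * T i * T (i + 1))
  | quadratic (i : ℕ) : Rel ((T i - 1) * (T i + algebraMap K (FreeAlgebra K Gen) tc)) 0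
  | X_succ (i : ℕ) : Rel (tc • (Tinv i * X i * Tinv i)) (X (i + 1))
  | T_X (i j : ℕ) (h : j ≠ i) (h' : j ≠ i + 1) : Rel (T i * X j) (X j * T i)
  | X_comm (i j : ℕ) : Rel (X i * X j) (X j * X i)
  | Y_succ (i : ℕ) : Rel (tc⁻¹ • (T i * Y i * T i)) (Y (i + 1))
  | T_Y (i j : ℕ) (h : j ≠ i) (h' : j ≠ i + 1) : Rel (T i * Y j) (Y j * T i)
  | Y_comm (i j : ℕ) : Rel (Y i * Y j) (Y j * Y i)
  | cross : Rel (Y 0 * T 0 * X 0) (X 1 * Y 0 * T 0)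

/-- The `+`stable limit double affine Hecke algebra `ℋ⁺`. -/
def H : Type := RingQuot Rel

noncomputable instance : Ring H := inferInstanceAs (Ring (RingQuot Rel))

noncomputable instance : Algebra K H := inferInstanceAs (Algebra K (RingQuot Rel))

/-- The quotient map onto `ℋ⁺`. -/
noncomputable def proj : FreeAlgebra K Gen →ₐ[K] H := RingQuot.mkAlgHom K Rel

/-- `T_{n+1} ∈ ℋ⁺`. -/
noncomputable def T (n : ℕ) : H := proj (Free.T n)

/-- `T_{n+1}⁻¹ ∈ ℋ⁺` (see `T_mul_Tinv` and `Tinv_mul_T`). -/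
noncomputable def Tinv (n : ℕ) : H := proj (Free.Tinv n)

/-- `X_{n+1} ∈ ℋ⁺`. -/
noncomputable def X (n : ℕ) : H := proj (Free.X n)

/-- `Y_{n+1} ∈ ℋ⁺`. -/
noncomputable def Y (n : ℕ) : H := proj (Free.Y n)

/-! ### The images of the generators under the two endomorphisms -/

/-- `u_n ⋯ u_1` (that is, `u (n-1) * ⋯ * u 0` with shifted indices). -/
def descProd {M : Type*} [Monoid M] (u : ℕ → M) (n : ℕ) : M :=
  ((List.range n).reverse.map u).prod

/-- `u_1 ⋯ u_n` (that is, `u 0 * ⋯ * u (n-1)` with shifted indices). -/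
def ascProd {M : Type*} [Monoid M] (u : ℕ → M) (n : ℕ) : M :=
  ((List.range n).map u).prod

/-- Images of the generators under `𝔞`: with `i = n + 1`,
`Y_i ↦ 𝓉^{1-i} (T_{i-1} ⋯ T_1) (T_1 ⋯ T_{i-1}) X_i Y_i`. -/
noncomputable def aGen : Gen → H
  | Gen.T n => T n
  | Gen.X n => X n
  | Gen.Y n => (tc⁻¹) ^ n • (descProd T n * ascProd T n * X n * Y n)

/-- Images of the generators under `𝔟`: with `i = n + 1`,
`X_i ↦ 𝓉^{i-1} (T_{i-1}⁻¹ ⋯ T_1⁻¹) (T_1⁻¹ ⋯ T_{i-1}⁻¹) Y_i X_i`. -/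
noncomputable def bGen : Gen → H
  | Gen.T n => T n
  | Gen.X n => tc ^ n • (descProd Tinv n * ascProd Tinv n * Y n * X n)
  | Gen.Y n => Y n

/-! ### Both assignments respect the defining relations -/

theorem tc_ne_zero : tc ≠ 0 := by
  unfold tc
  rw [Ne, IsFractionRing.to_map_eq_zero_iff]
  exact MvPolynomial.X_ne_zero 0

theorem proj_rel {x y : FreeAlgebra K Gen} (h : Rel x y) : proj x = proj y :=
  RingQuot.mkAlgHom_rel K h

theorem descProd_succ {M : Type*} [Monoid M] (u : ℕ → M) (n : ℕ) :
    descProd u (n + 1) = u n * descProd u n := by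
  simp [descProd, List.range_succ]

theorem ascProd_succ {M : Type*} [Monoid M] (u : ℕ → M) (n : ℕ) :
    ascProd u (n + 1) = ascProd u n * u n := by
  simp [ascProd, List.range_succ]

/-- The relations other than the quadratic one, for elements `t`, `t'` inverse to each other. -/
structure Sys {A : Type*} [Ring A] [Algebra K A] (s : K) (t t' x y : ℕ → A) : Prop where
  s_ne : s ≠ 0
  mul_inv : ∀ i, t i * t' i = 1
  inv_mul : ∀ i, t' i * t i = 1
  t_comm : ∀ i j, i + 1 < j ∨ j + 1 < i → Commute (t i) (t j)
  braid : ∀ i, t i * t (i + 1) * t i = t (i + 1) * t i * t (i + 1)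
  x_succ : ∀ i, x (i + 1) = s • (t' i * x i * t' i)
  t_x : ∀ i j, j ≠ i → j ≠ i + 1 → Commute (t i) (x j)
  x_comm : ∀ i j, Commute (x i) (x j)
  y_succ : ∀ i, y (i + 1) = s⁻¹ • (t i * y i * t i)
  t_y : ∀ i j, j ≠ i → j ≠ i + 1 → Commute (t i) (y j)
  y_comm : ∀ i j, Commute (y i) (y j)
  cross : y 0 * t 0 * x 0 = x 1 * y 0 * t 0

namespace Sys

variable {A : Type*} [Ring A] [Algebra K A] {s : K} {t t' x y : ℕ → A}

theorem inv_commute (h : Sys s t t' x y) {i : ℕ} {z : A} (hz : Commute (t i) z) :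
    Commute (t' i) z := by
  let u : Aˣ := ⟨t i, t' i, h.mul_inv i, h.inv_mul i⟩
  have : Commute (u : A) z := hz
  exact this.units_inv_left

/-- Swapping the roles of `x` and `y` inverts `t` and `s`. -/
theorem flip (h : Sys s t t' x y) : Sys s⁻¹ t' t y x where
  s_ne := inv_ne_zero h.s_ne
  mul_inv := h.inv_mul
  inv_mul := h.mul_inv
  t_comm i j hij := h.inv_commute (h.inv_commute (h.t_comm i j hij).symm).symm
  braid i := by
    let u : ℕ → Aˣ := fun i => ⟨t i, t' i, h.mul_inv i, h.inv_mul i⟩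
    have hb : u i * u (i + 1) * u i = u (i + 1) * u i * u (i + 1) := Units.ext (h.braid i)
    have hb' := congrArg (fun v : Aˣ => ((v⁻¹ : Aˣ) : A)) hb
    simpa [u, mul_assoc] using hb'
  x_succ := h.y_succ
  t_x i j h1 h2 := h.inv_commute (h.t_y i j h1 h2)
  x_comm := h.y_comm
  y_succ i := by rw [inv_inv]; exact h.x_succ i
  t_y i j h1 h2 := h.inv_commute (h.t_x i j h1 h2)
  y_comm := h.x_comm
  cross := by
    have hc := h.cross
    rw [h.x_succ 0] at hc
    have h1 : t 0 * (y 0 * t 0 * x 0) * t' 0 = s • (x 0 * t' 0 * y 0) := by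
      rw [hc]
      simp only [smul_mul_assoc, mul_smul_comm]
      congr 1
      calc t 0 * (t' 0 * x 0 * t' 0 * y 0 * t 0) * t' 0
          = (t 0 * t' 0) * x 0 * t' 0 * y 0 * (t 0 * t' 0) := by noncomm_ring
        _ = _ := by rw [h.mul_inv]; simp
    have h2 : y 1 = s⁻¹ • (t 0 * y 0 * t 0) := h.y_succ 0
    rw [h2]
    calc x 0 * t' 0 * y 0 = s⁻¹ • (s • (x 0 * t' 0 * y 0)) := by
            rw [smul_smul, inv_mul_cancel₀ h.s_ne, one_smul]
      _ = s⁻¹ • (t 0 * (y 0 * t 0 * x 0) * t' 0) := by rw [h1]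
      _ = _ := by simp only [smul_mul_assoc, mul_assoc]

/-- The twisted family replacing `y`. -/
noncomputable def tw (s : K) (t x y : ℕ → A) (n : ℕ) : A :=
  (s⁻¹) ^ n • (descProd t n * ascProd t n * x n * y n)

theorem tw_zero : tw s t x y 0 = x 0 * y 0 := by simp [tw, descProd, ascProd]

theorem tw_succ (h : Sys s t t' x y) (n : ℕ) :
    tw s t x y (n + 1) = s⁻¹ • (t n * tw s t x y n * t n) := by
  unfold tw
  rw [descProd_succ, ascProd_succ, h.x_succ, h.y_succ]
  simp only [smul_mul_assoc, mul_smul_comm, smul_smul]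
  congr 1
  · rw [pow_succ]
    field_simp [h.s_ne]
  · calc t n * descProd t n * (ascProd t n * t n) * (t' n * x n * t' n) * (t n * y n * t n)
        = t n * descProd t n * ascProd t n * (t n * t' n) * x n * (t' n * t n) * y n * t n := by
          noncomm_ring
      _ = _ := by rw [h.mul_inv, h.inv_mul]; simp [mul_assoc]

theorem t_tw_of_lt (h : Sys s t t' x y) (i j : ℕ) (hij : j < i) :
    Commute (t i) (tw s t x y j) := by
  induction j with
  | zero =>
    rw [tw_zero]
    exact (h.t_x i 0 (by omega) (by omega)).mul_right (h.t_y i 0 (by omega) (by omega))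
  | succ j ih =>
    rw [h.tw_succ]
    have h1 := h.t_comm i j (Or.inr hij)
    exact ((h1.mul_right (ih (by omega))).mul_right h1).smul_right _

theorem t_tw_add_two (h : Sys s t t' x y) (i : ℕ) : Commute (t i) (tw s t x y (i + 2)) := by
  rw [h.tw_succ (i + 1), h.tw_succ i]
  have hz : t (i + 1) * tw s t x y i = tw s t x y i * t (i + 1) :=
    h.t_tw_of_lt (i + 1) i (by omega)
  set z := tw s t x y i
  have hb := h.braid i
  set a := t i
  set b := t (i + 1)
  simp only [smul_mul_assoc, mul_smul_comm]
  refine (Commute.smul_right ?_ _).smul_right _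
  change a * (b * (a * z * a) * b) = b * (a * z * a) * b * a
  calc a * (b * (a * z * a) * b) = (a * b * a) * z * a * b := by noncomm_ring
    _ = b * a * (b * z) * a * b := by rw [hb]; noncomm_ring
    _ = b * a * z * (b * a * b) := by rw [hz]; noncomm_ring
    _ = b * (a * z * a) * b * a := by rw [← hb]; noncomm_ring

theorem t_tw (h : Sys s t t' x y) (i j : ℕ) (h1 : j ≠ i) (h2 : j ≠ i + 1) :
    Commute (t i) (tw s t x y j) := by
  rcases Nat.lt_or_gt_of_ne h1 with hlt | hgt
  · exact h.t_tw_of_lt i j hlt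
  · obtain ⟨k, rfl⟩ : ∃ k, j = i + 2 + k := ⟨j - (i + 2), by omega⟩
    clear h1 h2 hgt
    induction k with
    | zero => exact h.t_tw_add_two i
    | succ k ih =>
      rw [← add_assoc, h.tw_succ]
      have hc := h.t_comm i (i + 2 + k) (Or.inl (by omega))
      exact ((hc.mul_right ih).mul_right hc).smul_right _

theorem tw_zero_one (h : Sys s t t' x y) : Commute (tw s t x y 0) (tw s t x y 1) := by
  rw [h.tw_succ 0, tw_zero]
  refine Commute.smul_right ?_ _
  have hx1 : x 1 = s • (t' 0 * x 0 * t' 0) := h.x_succ 0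
  have hy1 : y 1 = s⁻¹ • (t 0 * y 0 * t 0) := h.y_succ 0
  have hc := h.cross
  have hxx : x 0 * x 1 = x 1 * x 0 := h.x_comm 0 1
  have hyy : y 0 * (t 0 * y 0 * t 0) = t 0 * y 0 * t 0 * y 0 := by
    have := (h.y_comm 0 1).smul_right s
    rw [hy1, smul_smul, mul_inv_cancel₀ h.s_ne, one_smul] at this
    exact this
  have hct : t 0 * (x 0 * x 1) = x 0 * x 1 * t 0 := by
    rw [hxx]
    nth_rewrite 1 [hx1]
    rw [← hxx, hx1]
    simp only [smul_mul_assoc, mul_smul_comm]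
    congr 1
    calc t 0 * (t' 0 * x 0 * t' 0 * x 0) = (t 0 * t' 0) * x 0 * t' 0 * x 0 := by noncomm_ring
      _ = x 0 * t' 0 * x 0 * (t' 0 * t 0) := by rw [h.mul_inv, h.inv_mul]; simp
      _ = x 0 * (t' 0 * x 0 * t' 0) * t 0 := by noncomm_ring
  change x 0 * y 0 * (t 0 * (x 0 * y 0) * t 0) = t 0 * (x 0 * y 0) * t 0 * (x 0 * y 0)
  symm
  calc t 0 * (x 0 * y 0) * t 0 * (x 0 * y 0)
      = t 0 * x 0 * (y 0 * t 0 * x 0) * y 0 := by noncomm_ring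
    _ = t 0 * (x 0 * x 1) * y 0 * t 0 * y 0 := by rw [hc]; noncomm_ring
    _ = x 0 * x 1 * (t 0 * y 0 * t 0 * y 0) := by rw [hct]; noncomm_ring
    _ = x 0 * (x 1 * y 0 * t 0) * y 0 * t 0 := by rw [← hyy]; noncomm_ring
    _ = x 0 * y 0 * (t 0 * (x 0 * y 0) * t 0) := by rw [← hc]; noncomm_ring

theorem tw_comm_lt (h : Sys s t t' x y) (i j : ℕ) (hij : i < j) :
    Commute (tw s t x y i) (tw s t x y j) := by
  induction i with
  | zero =>
    obtain ⟨k, rfl⟩ : ∃ k, j = k + 1 := ⟨j - 1, by omega⟩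
    clear hij
    induction k with
    | zero => exact h.tw_zero_one
    | succ k ih =>
      rw [h.tw_succ (k + 1)]
      have hc := (h.t_tw (k + 1) 0 (by omega) (by omega)).symm
      exact ((hc.mul_right ih).mul_right hc).smul_right _
  | succ i ih =>
    rw [h.tw_succ i]
    have hc := h.t_tw i j (by omega) (by omega)
    exact ((hc.mul_left (ih (by omega))).mul_left hc).smul_left _

theorem tw_comm (h : Sys s t t' x y) (i j : ℕ) :
    Commute (tw s t x y i) (tw s t x y j) := by
  rcases lt_trichotomy i j with hij | rfl | hij
  · exact h.tw_comm_lt i j hij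
  · exact Commute.refl _
  · exact (h.tw_comm_lt j i hij).symm

/-- The relations are preserved when `y` is replaced by the twisted family. -/
theorem twist (h : Sys s t t' x y) : Sys s t t' x (tw s t x y) where
  s_ne := h.s_ne
  mul_inv := h.mul_inv
  inv_mul := h.inv_mul
  t_comm := h.t_comm
  braid := h.braid
  x_succ := h.x_succ
  t_x := h.t_x
  x_comm := h.x_comm
  y_succ := h.tw_succ
  t_y := h.t_tw
  y_comm := h.tw_comm
  cross := by
    have hxx : x 0 * x 1 = x 1 * x 0 := h.x_comm 0 1
    rw [tw_zero]
    calc x 0 * y 0 * t 0 * x 0 = x 0 * (y 0 * t 0 * x 0) := by noncomm_ring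
      _ = x 0 * x 1 * y 0 * t 0 := by rw [h.cross]; noncomm_ring
      _ = x 1 * (x 0 * y 0) * t 0 := by rw [hxx]; noncomm_ring

end Sys

theorem T_quadratic (n : ℕ) : (T n - 1) * (T n + algebraMap K H tc) = 0 := by
  simpa [T] using proj_rel (Rel.quadratic n)

theorem Tinv_eq (n : ℕ) : Tinv n = tc⁻¹ • (T n + algebraMap K H (tc - 1)) := by
  simp only [Tinv, Free.Tinv, T, map_smul, map_add, AlgHom.commutes]

theorem T_mul_Tinv (n : ℕ) : T n * Tinv n = 1 := by
  have h := T_quadratic n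
  have h' : T n * (T n + algebraMap K H (tc - 1)) = algebraMap K H tc := by
    rw [map_sub, map_one]
    rw [← sub_eq_zero, ← h]
    simp only [mul_add, mul_sub, sub_mul, one_mul, mul_one]
    abel
  rw [Tinv_eq, mul_smul_comm, h', Algebra.smul_def, ← map_mul, inv_mul_cancel₀ tc_ne_zero,
    map_one]

theorem Tinv_mul_T (n : ℕ) : Tinv n * T n = 1 := by
  rw [← T_mul_Tinv n, Tinv_eq]
  simp only [smul_mul_assoc, mul_smul_comm, add_mul, mul_add, Algebra.commutes]

/-- The generators of `ℋ⁺` satisfy the relations. -/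
theorem sys : Sys tc T Tinv X Y where
  s_ne := tc_ne_zero
  mul_inv := T_mul_Tinv
  inv_mul := Tinv_mul_T
  t_comm i j h := by
    simpa [T, Commute, SemiconjBy] using proj_rel (Rel.T_comm i j h)
  braid i := by simpa [T] using proj_rel (Rel.T_braid i)
  x_succ i := by simpa [X, Tinv] using (proj_rel (Rel.X_succ i)).symm
  t_x i j h h' := by
    simpa [T, X, Commute, SemiconjBy] using proj_rel (Rel.T_X i j h h')
  x_comm i j := by simpa [X, Commute, SemiconjBy] using proj_rel (Rel.X_comm i j)
  y_succ i := by simpa [Y, T] using (proj_rel (Rel.Y_succ i)).symm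
  t_y i j h h' := by
    simpa [T, Y, Commute, SemiconjBy] using proj_rel (Rel.T_Y i j h h')
  y_comm i j := by simpa [Y, Commute, SemiconjBy] using proj_rel (Rel.Y_comm i j)
  cross := by simpa [T, X, Y] using proj_rel Rel.cross

/-- Images of the generators that fix every `T` and satisfy the relations respect `Rel`. -/
theorem lift_rel (g : Gen → H) (hT : ∀ n, g (Gen.T n) = T n)
    (h : Sys tc T Tinv (fun n => g (Gen.X n)) (fun n => g (Gen.Y n)))
    ⦃u v : FreeAlgebra K Gen⦄ (r : Rel u v) :
    FreeAlgebra.lift K g u = FreeAlgebra.lift K g v := by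
  have eT : ∀ n, FreeAlgebra.lift K g (Free.T n) = T n := fun n => by simp [Free.T, hT]
  have eX : ∀ n, FreeAlgebra.lift K g (Free.X n) = g (Gen.X n) := fun n => by simp [Free.X]
  have eY : ∀ n, FreeAlgebra.lift K g (Free.Y n) = g (Gen.Y n) := fun n => by simp [Free.Y]
  have eI : ∀ n, FreeAlgebra.lift K g (Free.Tinv n) = Tinv n := fun n => by
    rw [Tinv_eq]
    simp only [Free.Tinv, map_smul, map_add, AlgHom.commutes, eT]
  induction r with
  | T_comm i j hij => simpa only [map_mul, eT] using (h.t_comm i j hij).eq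
  | T_braid i => simpa only [map_mul, eT] using h.braid i
  | quadratic i =>
    simpa only [map_mul, map_sub, map_add, map_one, map_zero, AlgHom.commutes, eT]
      using T_quadratic i
  | X_succ i => simpa only [map_mul, map_smul, eI, eX] using (h.x_succ i).symm
  | T_X i j h1 h2 => simpa only [map_mul, eT, eX] using (h.t_x i j h1 h2).eq
  | X_comm i j => simpa only [map_mul, eX] using (h.x_comm i j).eq
  | Y_succ i => simpa only [map_mul, map_smul, eT, eY] using (h.y_succ i).symm
  | T_Y i j h1 h2 => simpa only [map_mul, eT, eY] using (h.t_y i j h1 h2).eq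
  | Y_comm i j => simpa only [map_mul, eY] using (h.y_comm i j).eq
  | cross => simpa only [map_mul, eT, eX, eY] using h.cross

theorem aGen_rel ⦃u v : FreeAlgebra K Gen⦄ (r : Rel u v) :
    FreeAlgebra.lift K aGen u = FreeAlgebra.lift K aGen v :=
  lift_rel aGen (fun _ => rfl) sys.twist r

theorem bGen_rel ⦃u v : FreeAlgebra K Gen⦄ (r : Rel u v) :
    FreeAlgebra.lift K bGen u = FreeAlgebra.lift K bGen v := by
  refine lift_rel bGen (fun _ => rfl) ?_ r
  have h := sys.flip.twist.flip
  simp only [inv_inv] at h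
  have e : (fun n => bGen (Gen.X n)) = Sys.tw tc⁻¹ Tinv Y X := by
    funext n
    simp only [bGen, Sys.tw, inv_inv]
  rw [e]
  exact h

/-! ### The endomorphisms -/

/-- The endomorphism `𝔞` of `ℋ⁺`. -/
noncomputable def fa : H →ₐ[K] H :=
  RingQuot.liftAlgHom K ⟨FreeAlgebra.lift K aGen, aGen_rel⟩

/-- The endomorphism `𝔟` of `ℋ⁺`. -/
noncomputable def fb : H →ₐ[K] H :=
  RingQuot.liftAlgHom K ⟨FreeAlgebra.lift K bGen, bGen_rel⟩

theorem fa_proj (u : FreeAlgebra K Gen) : fa (proj u) = FreeAlgebra.lift K aGen u :=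
  RingQuot.liftAlgHom_mkAlgHom_apply K _ aGen_rel u

theorem fb_proj (u : FreeAlgebra K Gen) : fb (proj u) = FreeAlgebra.lift K bGen u :=
  RingQuot.liftAlgHom_mkAlgHom_apply K _ bGen_rel u

theorem fa_T (n : ℕ) : fa (T n) = T n :=
  (fa_proj _).trans (FreeAlgebra.lift_ι_apply _ _)

theorem fa_X (n : ℕ) : fa (X n) = X n :=
  (fa_proj _).trans (FreeAlgebra.lift_ι_apply _ _)

theorem fa_Y (n : ℕ) :
    fa (Y n) = (tc⁻¹) ^ n • (descProd T n * ascProd T n * X n * Y n) :=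
  (fa_proj _).trans (FreeAlgebra.lift_ι_apply _ _)

theorem fb_T (n : ℕ) : fb (T n) = T n :=
  (fb_proj _).trans (FreeAlgebra.lift_ι_apply _ _)

theorem fb_Y (n : ℕ) : fb (Y n) = Y n :=
  (fb_proj _).trans (FreeAlgebra.lift_ι_apply _ _)

theorem fb_X (n : ℕ) :
    fb (X n) = tc ^ n • (descProd Tinv n * ascProd Tinv n * Y n * X n) :=
  (fb_proj _).trans (FreeAlgebra.lift_ι_apply _ _)

end StableDAHA

namespace StableDAHA

open Polynomial

/-! ### A representation of `ℋ⁺` on `K[x]` in which every `T_i` acts by `1` -/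

/-! On exponent vectors of monomials in $X_1, Y_1$, $\mathfrak a$ replaces the pair (vector of
$X_1$, vector of $Y_1$) $= (v, w)$ by $(v, v + w)$ and $\mathfrak b$ replaces it by $(v + w, w)$.
These are the elementary matrices generating a free monoid, by a Euclidean argument: the larger
vector reveals the last step, and subtraction undoes it (`bidegrees_injective`).

Exponent vectors must be well defined in $\mathscr{H}^+$, which needs a representation. Setting
every $T_i$ to 1 collapses the relations to $yx = \mathfrak t\,xy$, realised on $K[x]$ by
multiplication by $x$ and $f(x) \mapsto \mathfrak q f(\mathfrak t x)$. The $X$-exponent is then the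
shift in degree, and the $Y$-exponent is the power of $\mathfrak q$ (`HasBidegree.unique`). No
relation constrains $\mathfrak q$, so it is free to serve as this counter. -/

/-- Multiplication by `x` on `K[x]`. -/
noncomputable def xOp : Module.End K K[X] := LinearMap.mulLeft K (Polynomial.X : K[X])

/-- The operator `f(x) ↦ 𝓆 f(𝓉 x)` on `K[x]`. -/
noncomputable def yOp : Module.End K K[X] :=
  qc • (aeval (C tc * Polynomial.X : K[X])).toLinearMap

/-- Substituting $\mathfrak t x$ turns a factor $x$ into $\mathfrak t x$. This is the cross relation
once $T_1$ acts by 1 and $X_2$ by $\mathfrak t x$. -/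
theorem yOp_mul_xOp : yOp * xOp = tc • (xOp * yOp) := by
  refine LinearMap.ext fun f => ?_
  simp only [yOp, xOp, Module.End.mul_apply, LinearMap.smul_apply, LinearMap.mulLeft_apply,
    AlgHom.toLinearMap_apply, map_mul, aeval_X, mul_smul_comm, ← smul_eq_C_mul, smul_mul_assoc]
  rw [smul_comm]

/-- The action of the generators on `K[x]`. -/
noncomputable def opGen : Gen → Module.End K K[X]
  | Gen.T _ => 1
  | Gen.X n => tc ^ n • xOp
  | Gen.Y n => (tc⁻¹) ^ n • yOp

/-- With $T_i = 1$ the factor $T_i - 1$ kills the quadratic relation, and the recursions for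
$X_{i+1}$, $Y_{i+1}$ become scalings by $\mathfrak t^{\pm 1}$, whence the powers in `opGen`. Only
the cross relation involves noncommuting operators. -/
theorem opGen_rel ⦃u v : FreeAlgebra K Gen⦄ (r : Rel u v) :
    FreeAlgebra.lift K opGen u = FreeAlgebra.lift K opGen v := by
  have eT : ∀ n, FreeAlgebra.lift K opGen (Free.T n) = 1 := fun n => by simp [Free.T, opGen]
  have eX : ∀ n, FreeAlgebra.lift K opGen (Free.X n) = tc ^ n • xOp := fun n => by
    simp [Free.X, opGen]
  have eY : ∀ n, FreeAlgebra.lift K opGen (Free.Y n) = (tc⁻¹) ^ n • yOp := fun n => by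
    simp [Free.Y, opGen]
  have eI : ∀ n, FreeAlgebra.lift K opGen (Free.Tinv n) = 1 := fun n => by
    simp only [Free.Tinv, map_smul, map_add, AlgHom.commutes, eT]
    rw [map_sub, map_one, add_sub_cancel, Algebra.algebraMap_eq_smul_one, smul_smul,
      inv_mul_cancel₀ tc_ne_zero, one_smul]
  induction r with
  | T_comm i j hij => simp only [map_mul, eT]
  | T_braid i => simp only [map_mul, eT]
  | quadratic i => simp only [map_mul, map_sub, map_one, eT, sub_self, zero_mul, map_zero]
  | X_succ i => simp only [map_mul, map_smul, eI, eX, one_mul, mul_one, smul_smul, pow_succ']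
  | T_X i j h1 h2 => simp only [map_mul, eT, eX, one_mul, mul_one]
  | X_comm i j =>
    simp only [map_mul, eX, smul_mul_assoc, mul_smul_comm]
    rw [smul_comm]
  | Y_succ i => simp only [map_mul, map_smul, eT, eY, one_mul, mul_one, smul_smul, pow_succ']
  | T_Y i j h1 h2 => simp only [map_mul, eT, eY, one_mul, mul_one]
  | Y_comm i j =>
    simp only [map_mul, eY, smul_mul_assoc, mul_smul_comm]
    rw [smul_comm]
  | cross =>
    simp only [map_mul, eT, eX, eY, mul_one, pow_zero, one_smul, pow_one,
      smul_mul_assoc, yOp_mul_xOp]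

/-- The representation of `ℋ⁺` on `K[x]`. -/
noncomputable def rep : H →ₐ[K] Module.End K K[X] :=
  RingQuot.liftAlgHom K ⟨FreeAlgebra.lift K opGen, opGen_rel⟩

theorem rep_proj (u : FreeAlgebra K Gen) : rep (proj u) = FreeAlgebra.lift K opGen u :=
  RingQuot.liftAlgHom_mkAlgHom_apply K _ opGen_rel u

theorem rep_X_zero : rep (X 0) = xOp :=
  (rep_proj _).trans <| (FreeAlgebra.lift_ι_apply _ _).trans <| by simp [opGen]

theorem rep_Y_zero : rep (Y 0) = yOp :=
  (rep_proj _).trans <| (FreeAlgebra.lift_ι_apply _ _).trans <| by simp [opGen]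

/-! ### Elements acting as monomials -/

/-- `h` acts on `K[x]` as a monomial of degree `p` in `X_1` and `r` in `Y_1`, up to powers
of `𝓉`. -/
def HasBidegree (h : H) (d : ℕ × ℕ) : Prop :=
  ∃ s : ℕ → ℕ, ∀ n, rep h (Polynomial.X ^ n) = (qc ^ d.2 * tc ^ s n) • Polynomial.X ^ (n + d.1)

theorem hasBidegree_X_zero : HasBidegree (X 0) (1, 0) :=
  ⟨fun _ => 0, fun n => by simp [rep_X_zero, xOp, pow_succ']⟩

theorem hasBidegree_Y_zero : HasBidegree (Y 0) (0, 1) :=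
  -- $Y_1$ sends $x^n$ to $\mathfrak q\,\mathfrak t^n x^n$, so the power of $\mathfrak t$ has to
  -- depend on $n$.
  ⟨fun n => n, fun n => by
    simp only [rep_Y_zero, yOp, LinearMap.smul_apply, AlgHom.toLinearMap_apply, map_pow, aeval_X,
      ← smul_eq_C_mul, _root_.smul_pow, smul_smul, pow_one, add_zero]⟩

theorem HasBidegree.mul {h h' : H} {d d' : ℕ × ℕ} (H₁ : HasBidegree h d)
    (H₂ : HasBidegree h' d') : HasBidegree (h * h') (d + d') := by
  obtain ⟨s, hs⟩ := H₁
  obtain ⟨s', hs'⟩ := H₂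
  -- `h'` acts first, so `h` meets a monomial of degree `n + d'.1`.
  refine ⟨fun n => s (n + d'.1) + s' n, fun n => ?_⟩
  rw [map_mul, Module.End.mul_apply, hs', map_smul, hs, smul_smul, Prod.fst_add, Prod.snd_add,
    add_assoc n, add_comm d'.1]
  congr 1
  ring

theorem qc_ne_zero : qc ≠ 0 := by
  unfold qc
  rw [Ne, IsFractionRing.to_map_eq_zero_iff]
  exact MvPolynomial.X_ne_zero 1

/-- The equality descends to the polynomial ring, where the degree in the variable $\mathfrak q$
(index 1) is compared. -/
theorem qc_pow_mul_tc_pow_inj {r s r' s' : ℕ} (h : qc ^ r * tc ^ s = qc ^ r' * tc ^ s') :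
    r = r' := by
  simp only [qc, tc, ← map_pow, ← map_mul] at h
  have h' := IsFractionRing.injective (MvPolynomial (Fin 2) ℚ) K h
  have hd := congrArg (MvPolynomial.degreeOf 1) h'
  have key : ∀ r s : ℕ, (MvPolynomial.X 1 ^ r * MvPolynomial.X 0 ^ s : MvPolynomial (Fin 2) ℚ)
      = MvPolynomial.monomial (Finsupp.single 1 r + Finsupp.single 0 s) 1 := fun r s => by
    rw [MvPolynomial.X_pow_eq_monomial, MvPolynomial.X_pow_eq_monomial,
      MvPolynomial.monomial_mul, one_mul]
  rw [key, key, MvPolynomial.degreeOf_monomial_eq _ _ one_ne_zero,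
    MvPolynomial.degreeOf_monomial_eq _ _ one_ne_zero] at hd
  simpa using hd

/-- The image of $1 = x^0$ is a nonzero monomial: its degree gives one exponent, the power of
$\mathfrak q$ in its coefficient the other. -/
theorem HasBidegree.unique {h : H} {d d' : ℕ × ℕ} (H₁ : HasBidegree h d)
    (H₂ : HasBidegree h d') : d = d' := by
  obtain ⟨s, hs⟩ := H₁
  obtain ⟨s', hs'⟩ := H₂
  have e := (hs 0).symm.trans (hs' 0)
  simp only [zero_add, smul_eq_C_mul, C_mul_X_pow_eq_monomial] at e
  have hne : qc ^ d.2 * tc ^ s 0 ≠ 0 :=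
    mul_ne_zero (pow_ne_zero _ qc_ne_zero) (pow_ne_zero _ tc_ne_zero)
  rcases (monomial_eq_monomial_iff).1 e with ⟨h1, h2⟩ | ⟨h1, -⟩
  · exact Prod.ext h1 (qc_pow_mul_tc_pow_inj h2)
  · exact absurd h1 hne

/-! ### Freeness -/

/-- The exponent vectors of the images of `X_1` and `Y_1` under the composite of the letters of
a word, read from right to left. -/
def bidegrees : List (Fin 2) → (ℕ × ℕ) × (ℕ × ℕ)
  | [] => ((1, 0), (0, 1))
  | i :: l =>
    if i = 0 then ((bidegrees l).1, (bidegrees l).1 + (bidegrees l).2)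
    else ((bidegrees l).2 + (bidegrees l).1, (bidegrees l).2)

/-- Positive total degrees make each letter strictly enlarge one vector beyond the other. -/
theorem bidegrees_pos (l : List (Fin 2)) :
    0 < (bidegrees l).1.1 + (bidegrees l).1.2 ∧ 0 < (bidegrees l).2.1 + (bidegrees l).2.2 := by
  induction l with
  | nil => simp [bidegrees]
  | cons i l ih =>
    rw [bidegrees]
    split_ifs <;> simp only [Prod.fst_add, Prod.snd_add] <;> omega

/-- For the empty word both total degrees are 1. Otherwise the head letter is 0 when the second
vector has the larger total degree and 1 when the first has; subtracting the smaller vector recovers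
the pair of the tail. -/
theorem bidegrees_injective : Function.Injective bidegrees := by
  intro l
  induction l with
  | nil =>
    rintro (_ | ⟨j, m⟩) h
    · rfl
    · have := bidegrees_pos m
      rw [bidegrees, bidegrees] at h
      split_ifs at h <;> simp only [Prod.ext_iff, Prod.fst_add, Prod.snd_add] at h <;> omega
  | cons i l ih =>
    rintro (_ | ⟨j, m⟩) h
    · have := bidegrees_pos l
      rw [bidegrees, bidegrees] at h
      split_ifs at h <;> simp only [Prod.ext_iff, Prod.fst_add, Prod.snd_add] at h <;> omega
    · have hl := bidegrees_pos l
      have hm := bidegrees_pos m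
      have key : i = j ∧ bidegrees l = bidegrees m := by
        rw [bidegrees, bidegrees] at h
        split_ifs at h <;> simp only [Prod.ext_iff, Prod.fst_add, Prod.snd_add] at h ⊢ <;> omega
      rw [key.1, ih key.2]

/-- The homomorphism from the free monoid on two letters sending them to `𝔞` and `𝔟`. -/
noncomputable def wordHom : FreeMonoid (Fin 2) →* (H →ₐ[K] H) :=
  FreeMonoid.lift ![fa, fb]

theorem fa_Y_zero : fa (Y 0) = X 0 * Y 0 := by simp [fa_Y, descProd, ascProd]

theorem fb_X_zero : fb (X 0) = Y 0 * X 0 := by simp [fb_X, descProd, ascProd]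

/-- The word is reversed so that the head of `l` is the innermost endomorphism. It turns $X_1$,
$Y_1$ into products of $X_1$, $Y_1$, on which the remaining composite is multiplicative, so the
induction needs only these two elements. -/
theorem wordHom_hasBidegree (l : List (Fin 2)) :
    HasBidegree (wordHom (FreeMonoid.ofList l.reverse) (X 0)) (bidegrees l).1 ∧
    HasBidegree (wordHom (FreeMonoid.ofList l.reverse) (Y 0)) (bidegrees l).2 := by
  induction l with
  | nil => exact ⟨hasBidegree_X_zero, hasBidegree_Y_zero⟩
  | cons i l ih =>
    rw [List.reverse_cons, FreeMonoid.ofList_append, map_mul, FreeMonoid.ofList_singleton]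
    obtain ⟨hX, hY⟩ := ih
    fin_cases i
    · have e : wordHom (FreeMonoid.of 0) = fa := by simp [wordHom]
      simp only [Fin.zero_eta, e, AlgHom.mul_apply, fa_X, fa_Y_zero, map_mul, bidegrees, if_true]
      exact ⟨hX, hX.mul hY⟩
    · have e : wordHom (FreeMonoid.of 1) = fb := by simp [wordHom]
      simp only [Fin.mk_one, e, AlgHom.mul_apply, fb_X_zero, fb_Y, map_mul, bidegrees,
        one_ne_zero, if_false]
      exact ⟨hY.mul hX, hY⟩

theorem wordHom_injective : Function.Injective wordHom := by
  intro u v h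
  have hu := wordHom_hasBidegree u.toList.reverse
  have hv := wordHom_hasBidegree v.toList.reverse
  rw [List.reverse_reverse, FreeMonoid.ofList_toList] at hu hv
  rw [h] at hu
  have := bidegrees_injective (Prod.ext (hu.1.unique hv.1) (hu.2.unique hv.2))
  exact FreeMonoid.toList.injective (List.reverse_injective this)

theorem mrange_wordHom :
    MonoidHom.mrange wordHom = Submonoid.closure ({fa, fb} : Set (H →ₐ[K] H)) := by
  rw [wordHom, FreeMonoid.mrange_lift, Matrix.range_cons, Matrix.range_cons, Matrix.range_empty,
    Set.union_empty, Set.singleton_union]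

end StableDAHA

theorem mainTheorem8 :
    ∃ e : FreeMonoid (Fin 2) ≃*
        Submonoid.closure
          ({StableDAHA.fa, StableDAHA.fb} : Set (StableDAHA.H →ₐ[StableDAHA.K] StableDAHA.H)),
      (e (FreeMonoid.of 0) : StableDAHA.H →ₐ[StableDAHA.K] StableDAHA.H) = StableDAHA.fa ∧
      (e (FreeMonoid.of 1) : StableDAHA.H →ₐ[StableDAHA.K] StableDAHA.H) = StableDAHA.fb := by
  refine ⟨(MulEquiv.ofBijective StableDAHA.wordHom.mrangeRestrict
    ⟨fun u v h => StableDAHA.wordHom_injective (congrArg Subtype.val h),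
      StableDAHA.wordHom.mrangeRestrict_surjective⟩).trans
    (MulEquiv.submonoidCongr StableDAHA.mrange_wordHom), ?_, ?_⟩
  · change StableDAHA.wordHom (FreeMonoid.of 0) = _
    simp [StableDAHA.wordHom]
  · change StableDAHA.wordHom (FreeMonoid.of 1) = _
    simp [StableDAHA.wordHom]
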